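/- Let $\mathbb{S}$ be a Steiner triple system on $k \ge 3$ vertices, i.e. a $3$-graph ($3$-uniform hypergraph) with $k$ vertices in which every pair of distinct vertices is contained in exactly one edge. Let $\mathbb{C}_3$ be the family of $3$-graphs consisting of three distinct edges $A, B, C$ such that the symmetric difference $A \triangle B$ is contained in $C$. Let $\mathrm{ex}(n,\mathbb{S},\mathbb{C}_3)$ denote the maximum number of copies of $\mathbb{S}$ (subgraphs isomorphic to $\mathbb{S}$) in an $n$-vertex $3$-graph that contains no member of $\mathbb{C}_3$ as a subgraph. Then there exists $n_0 = n_0(\mathbb{S})$ such that, for all $n \ge n_0$, $$\mathrm{ex}(n,\mathbb{S},\mathbb{C}_3) = |T^k(n)|,$$ where $T^k(n)$ is the balanced complete $k$-partite $k$-graph on $n$ vertices (the vertex set is partitioned into $k$ parts whose sizes differ by at most one, and the edges are the $k$-sets with exactly one vertex in every part) and $|T^k(n)|$ is its number of edges. -/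

import Mathlib

/-- An `r`-uniform hypergraph (`r`-graph) with vertex set `V`. -/
@[ext]
structure RGraph (r : ℕ) (V : Type*) where
  /-- the set of edges -/
  edges : Finset (Finset V)
  card_eq : ∀ e ∈ edges, e.card = r

namespace RGraph

/-- The set of edges `{f(e) : e ∈ G}`, for an injective map `f` defined on the vertices of `G`. -/
def mapEdges {r : ℕ} {U W : Type*} (G : RGraph r U) (f : U ↪ W) : Finset (Finset W) :=
  G.edges.map (Finset.mapEmbedding f).toEmbedding

/-- `H` contains `F` as a (not necessarily induced) subgraph. -/
def Contains {r : ℕ} {U W : Type*} (H : RGraph r W) (F : RGraph r U) : Prop :=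
  ∃ f : U ↪ W, F.mapEdges f ⊆ H.edges

/-- A family of finite `r`-graphs, given by its members on the vertex sets `Fin m`. -/
abbrev Family (r : ℕ) : Type := (m : ℕ) → Set (RGraph r (Fin m))

/-- `H` is `𝓕`-free: no member of `𝓕` is a subgraph of `H`. -/
def IsFree {r : ℕ} {W : Type*} (H : RGraph r W) (𝓕 : Family r) : Prop :=
  ∀ (m : ℕ), ∀ F ∈ 𝓕 m, ¬ H.Contains F

/-- The family of the `r`-graphs that consist of three (distinct) edges `A`, `B`, `C` such that the
symmetric difference of `A` and `B` is contained in `C`. -/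
def cancellativeFamily (r : ℕ) : Family r := fun m =>
  {F | ∃ A B C : Finset (Fin m), A ≠ B ∧ A ≠ C ∧ B ≠ C ∧
    F.edges = {A, B, C} ∧ symmDiff A B ⊆ C}

/-- The subgraph of `H` with vertex set `X` and edge set `E` is a copy of `S`, that is, it is a
subgraph of `H` that is isomorphic to `S`. -/
def IsCopy {r : ℕ} {U W : Type*} [Fintype U] (S : RGraph r U) (H : RGraph r W)
    (X : Finset W) (E : Finset (Finset W)) : Prop :=
  E ⊆ H.edges ∧ ∃ f : U ↪ W, Finset.univ.map f = X ∧ S.mapEdges f = E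

/-- The number of (unlabelled) copies of `S` in `H`. -/
noncomputable def numCopies {r : ℕ} {U W : Type*} [Fintype U] (S : RGraph r U)
    (H : RGraph r W) : ℕ :=
  {P : Finset W × Finset (Finset W) | IsCopy S H P.1 P.2}.ncard

/-- The generalized Turán number: the maximum number of copies of `S` in an `n`-vertex `𝓕`-free
`r`-graph. -/
noncomputable def generalizedTuranNumber {r : ℕ} {U : Type*} [Fintype U] (n : ℕ)
    (S : RGraph r U) (𝓕 : Family r) : ℕ :=
  sSup {N : ℕ | ∃ H : RGraph r (Fin n), H.IsFree 𝓕 ∧ numCopies S H = N}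

/-- A Steiner triple system: a `3`-graph such that every pair of vertices is contained in exactly
one edge. -/
def IsSteinerTripleSystem {V : Type*} (S : RGraph 3 V) : Prop :=
  ∀ u v : V, u ≠ v → ∃! e : Finset V, e ∈ S.edges ∧ u ∈ e ∧ v ∈ e

/-- The balanced complete `k`-partite `k`-graph on `n` vertices. Its parts are the residue classes
modulo `k`, and its edges are the `k`-sets with exactly one vertex in every part. -/
def balancedCompletePartite (k n : ℕ) : RGraph k (Fin n) where
  edges := (Finset.powersetCard k Finset.univ).filter fun e =>
    ∀ j < k, (e.filter fun x : Fin n => (x : ℕ) % k = j).card = 1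
  card_eq := fun _ he => (Finset.mem_powersetCard.1 (Finset.mem_filter.1 he).1).2

/-- On the vertex set `Fin n`, being free of the family above has the expected meaning. -/
theorem isFree_cancellativeFamily_iff {r n : ℕ} (H : RGraph r (Fin n)) :
    H.IsFree (cancellativeFamily r) ↔
      ∀ A ∈ H.edges, ∀ B ∈ H.edges, ∀ C ∈ H.edges, A ≠ B → A ≠ C → B ≠ C →
        ¬ symmDiff A B ⊆ C := by
  constructor
  · intro h A hA B hB C hC hAB hAC hBC hs
    have hsub : ({A, B, C} : Finset (Finset (Fin n))) ⊆ H.edges := by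
      intro e he
      simp only [Finset.mem_insert, Finset.mem_singleton] at he
      rcases he with rfl | rfl | rfl <;> assumption
    refine h n ⟨{A, B, C}, fun e he => H.card_eq e (hsub he)⟩
      ⟨A, B, C, hAB, hAC, hBC, rfl, hs⟩ ⟨Function.Embedding.refl _, ?_⟩
    intro e he
    obtain ⟨e', he', rfl⟩ := Finset.mem_map.1 he
    simpa using hsub he'
  · rintro h m F ⟨A, B, C, hAB, hAC, hBC, hF, hs⟩ ⟨f, hf⟩
    have key : ∀ e ∈ F.edges, e.map f ∈ H.edges := fun e he =>
      hf (Finset.mem_map.2 ⟨e, he, rfl⟩)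
    have inj : ∀ {X Y : Finset (Fin m)}, X ≠ Y → X.map f ≠ Y.map f := fun hXY hm =>
      hXY (Finset.map_injective f hm)
    refine h _ (key A (by simp [hF])) _ (key B (by simp [hF])) _ (key C (by simp [hF]))
      (inj hAB) (inj hAC) (inj hBC) ?_
    intro x hx
    rw [Finset.mem_symmDiff] at hx
    simp only [Finset.mem_map] at hx
    rcases hx with ⟨⟨a, ha, rfl⟩, hb⟩ | ⟨⟨a, ha, rfl⟩, hb⟩
    · exact Finset.mem_map_of_mem f
        (hs (Finset.mem_symmDiff.2 (Or.inl ⟨ha, fun h' => hb ⟨a, h', rfl⟩⟩)))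
    · exact Finset.mem_map_of_mem f
        (hs (Finset.mem_symmDiff.2 (Or.inr ⟨ha, fun h' => hb ⟨a, h', rfl⟩⟩)))

/-- For the family above, the supremum in the definition of the generalized Turán number is
a maximum. -/
theorem isGreatest_generalizedTuranNumber {r : ℕ} {U : Type*} [Fintype U] (n : ℕ)
    (S : RGraph r U) :
    IsGreatest {N : ℕ | ∃ H : RGraph r (Fin n),
        H.IsFree (cancellativeFamily r) ∧ numCopies S H = N}
      (generalizedTuranNumber n S (cancellativeFamily r)) := by
  have hne : {N : ℕ | ∃ H : RGraph r (Fin n),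
      H.IsFree (cancellativeFamily r) ∧ numCopies S H = N}.Nonempty :=
    ⟨_, ⟨∅, by simp⟩, (isFree_cancellativeFamily_iff _).2 (by simp), rfl⟩
  have hbd : BddAbove {N : ℕ | ∃ H : RGraph r (Fin n),
      H.IsFree (cancellativeFamily r) ∧ numCopies S H = N} := by
    refine ⟨Nat.card (Finset (Fin n) × Finset (Finset (Fin n))), ?_⟩
    rintro N ⟨H, -, rfl⟩
    exact Set.ncard_le_card _
  exact ⟨Nat.sSup_mem hne hbd, fun N hN => le_csSup hbd hN⟩

end RGraph

/-!
Let `H` be a cancellative `3`-graph on `n` vertices. Every copy of the Steiner triple system `S`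
in `H` is determined by its vertex set, and this set is a clique of the shadow of `H` (the graph of
the pairs covered by edges). So the number of copies is the value at `x = (1, …, 1)` of
`P x = ∑ Y, ∏ i ∈ Y, x i`, where `Y` runs over the vertex sets of copies.

No monomial of `P` contains two vertices `u`, `v` that are not adjacent in the shadow, hence `P` is
affine while weight is moved between `u` and `v`, and moving all of it in one of the two directions
does not decrease `P` (`exists_weight_on_clique`). This leaves natural weights of total `n`
supported on a clique `W` of the shadow. Inside a clique, cancellativity says that every pair lies
in at most one edge, so two different copies in `W` meet in a proper subsystem of both and share at
most `(k - 1) / 2` vertices (`two_mul_card_inter_lt`).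

It remains to bound `P` for such a family of `k`-sets (`sum_prod_le_prod_residueCard`). Let `Y₀` be
the member of largest weight `M`, let `r = n - M`, and put `t = (k + 1) / 2`. No `t`-set lies in two
members, so the elementary symmetric sums of degree `t` over the members add up to at most the one
over `W`. Maclaurin's inequalities bound the product over `Y` by this symmetric sum times
`M ^ (k - t)`, up to a constant, and comparing coefficients of `M ^ (k - j) * r ^ j` gives
`k ^ k * P ≤ n ^ k - r ^ k` (`pow_mul_sum_prod_le`). Since `|T^k(n)|` is `(n / k) ^ k` up to
`O(n ^ (k - 2))`, this suffices when `r` is a positive proportion of `n`. For smaller `r ≥ 1` the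
sets other than `Y₀`, having two points outside `Y₀`, contribute at most `r ^ 2 * n ^ (k - 2)`
(`sum_prod_le_prod_add`), which is less than what `Y₀` loses by having weight `n - r` only. For
`r = 0` there remains a single product of `k` natural numbers with sum `n`, which is largest when
they are balanced (`prod_le_prod_residueCard`).

Conversely, the balanced blow-up of `S` is cancellative, and every transversal of its parts spans
a copy of `S`.
-/

/-! ### Elementary symmetric sums -/

/-- The elementary symmetric sum of degree `j` of the real weights `x i`, `i ∈ s`. -/
def elemSymm {ι : Type*} (x : ι → ℝ) (s : Finset ι) (j : ℕ) : ℝ :=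
  ∑ A ∈ s.powersetCard j, ∏ i ∈ A, x i

section ElemSymm

variable {ι : Type*} {x : ι → ℝ}

lemma elemSymm_zero (x : ι → ℝ) (s : Finset ι) : elemSymm x s 0 = 1 := by
  simp [elemSymm]

lemma elemSymm_card (x : ι → ℝ) (s : Finset ι) : elemSymm x s s.card = ∏ i ∈ s, x i := by
  simp [elemSymm]

lemma elemSymm_nonneg (hx : ∀ i, 0 ≤ x i) (s : Finset ι) (j : ℕ) : 0 ≤ elemSymm x s j :=
  Finset.sum_nonneg fun _ _ => Finset.prod_nonneg fun i _ => hx i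

lemma elemSymm_eq_zero (x : ι → ℝ) {s : Finset ι} {j : ℕ} (h : s.card < j) :
    elemSymm x s j = 0 := by
  simp [elemSymm, Finset.powersetCard_eq_empty.2 h]

variable [DecidableEq ι]

lemma elemSymm_insert {a : ι} {s : Finset ι} (ha : a ∉ s) (j : ℕ) :
    elemSymm x (insert a s) (j + 1) = elemSymm x s (j + 1) + x a * elemSymm x s j := by
  unfold elemSymm
  rw [Finset.powersetCard_succ_insert ha, Finset.sum_union, Finset.sum_image, Finset.mul_sum]
  · congr 1
    refine Finset.sum_congr rfl fun A hA => ?_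
    rw [Finset.prod_insert fun h => ha ((Finset.mem_powersetCard.1 hA).1 h)]
  · intro A hA B hB h
    have h1 : a ∉ A := fun h => ha ((Finset.mem_powersetCard.1 hA).1 h)
    have h2 : a ∉ B := fun h => ha ((Finset.mem_powersetCard.1 hB).1 h)
    rw [← Finset.erase_insert h1, ← Finset.erase_insert h2, h]
  · rw [Finset.disjoint_left]
    intro A hA hA'
    obtain ⟨B, -, rfl⟩ := Finset.mem_image.1 hA'
    exact ha ((Finset.mem_powersetCard.1 hA).1 (Finset.mem_insert_self a B))

/-- One step of Maclaurin's inequalities: the normalised symmetric means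
`p j = elemSymm x s j / s.card.choose j` satisfy `p (j + 1) ≤ p 1 * p j`. -/
lemma elemSymm_succ_le (hx : ∀ i, 0 ≤ x i) (s : Finset ι) (j : ℕ) :
    s.card * ((j + 1) * elemSymm x s (j + 1)) ≤
      (s.card - j) * ((∑ i ∈ s, x i) * elemSymm x s j) := by
  induction s using Finset.induction_on generalizing j with
  | empty => simp
  | insert y s hy ih =>
    rw [Finset.card_insert_of_notMem hy, Finset.sum_insert hy, elemSymm_insert hy]
    rcases s.eq_empty_or_nonempty with rfl | hs
    · rcases j with _ | j
      · have h0 : elemSymm x ∅ 1 = 0 := elemSymm_eq_zero x (by simp)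
        simp [elemSymm_zero, h0]
      · rw [elemSymm_eq_zero (s := ∅) x (by simp), elemSymm_eq_zero (s := ∅) x (by simp)]
        rcases j with _ | j
        · simp
        · rw [elemSymm_eq_zero x (by simp)]
          simp
    have hk : (0 : ℝ) < s.card := by exact_mod_cast hs.card_pos
    have ha : 0 ≤ ∑ i ∈ s, x i := Finset.sum_nonneg fun i _ => hx i
    rcases j with _ | j
    · have h0 := ih 0
      simp only [elemSymm_zero] at h0 ⊢
      push_cast at h0 ⊢
      have : elemSymm x s (0 + 1) ≤ ∑ i ∈ s, x i := by
        have h1 : (s.card : ℝ) * elemSymm x s (0 + 1) ≤ s.card * ∑ i ∈ s, x i := by linarith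
        exact le_of_mul_le_mul_left h1 hk
      have := mul_le_mul_of_nonneg_left this (by positivity : (0 : ℝ) ≤ s.card + 1)
      linarith
    · rw [elemSymm_insert hy]
      have h1 := ih (j + 1)
      have h2 := ih j
      have e0 := elemSymm_nonneg hx s j
      have e1 := elemSymm_nonneg hx s (j + 1)
      have hP : (s.card : ℝ) < j → elemSymm x s j = 0 := fun h =>
        elemSymm_eq_zero x (by exact_mod_cast h)
      have hyx := hx y
      push_cast at h1 h2 ⊢
      generalize elemSymm x s j = P at *
      generalize elemSymm x s (j + 1) = Q at *
      generalize elemSymm x s (j + 1 + 1) = R at *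
      generalize (∑ i ∈ s, x i) = a at *
      generalize x y = b at *
      generalize (s.card : ℝ) = K at *
      have hj : (0 : ℝ) ≤ j := Nat.cast_nonneg j
      generalize (j : ℝ) = J at *
      -- the error term is a multiple of `(a - K * b) ^ 2`
      have key : 0 ≤ (J + 1) * a * Q - 2 * (J + 1) * K * b * Q + K * b ^ 2 * ((K - J) * P) := by
        rcases ha.eq_or_lt with rfl | ha
        · have hQ : Q = 0 := by
            have : 0 ≤ K * (J + 1) := by positivity
            have h3 : K * (J + 1) * Q ≤ 0 := by nlinarith
            have h4 : 0 < K * (J + 1) := by positivity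
            nlinarith
          subst hQ
          have h5 : 0 ≤ (K - J) * P ∨ P = 0 := by
            by_cases hKJ : J ≤ K
            · left; exact mul_nonneg (by linarith) e0
            · exact Or.inr (hP (not_le.1 hKJ))
          rcases h5 with h5 | h5
          · have := mul_nonneg (by positivity : 0 ≤ K * b ^ 2) h5
            linarith
          · simp [h5]
        · have h3 : 0 ≤ (J + 1) * Q * (a - K * b) ^ 2 := by positivity
          have h4 := mul_le_mul_of_nonneg_left h2 (by positivity : 0 ≤ K * b ^ 2)
          have h5 : 0 ≤ a * ((J + 1) * a * Q - 2 * (J + 1) * K * b * Q +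
              K * b ^ 2 * ((K - J) * P)) := by nlinarith
          exact nonneg_of_mul_nonneg_right h5 ha
      have h6 := mul_le_mul_of_nonneg_left h1 (by positivity : 0 ≤ K + 1)
      have h7 := mul_le_mul_of_nonneg_left h2 (by positivity : 0 ≤ K * b)
      have h8 : K * ((K + 1) * ((J + 1 + 1) * (R + b * Q))) ≤
          K * ((K + 1 - (J + 1)) * ((b + a) * (Q + b * P))) := by nlinarith
      exact le_of_mul_le_mul_left h8 hk

/-- Maclaurin's inequalities in the form
`p (a + i) ≤ p 1 ^ i * p a`, for the normalised symmetric means `p`. -/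
lemma choose_mul_elemSymm_add_le (hx : ∀ i, 0 ≤ x i) (s : Finset ι) (a i : ℕ)
    (h : a + i ≤ s.card) :
    (s.card.choose a : ℝ) * ((s.card : ℝ) ^ i * elemSymm x s (a + i)) ≤
      s.card.choose (a + i) * ((∑ i ∈ s, x i) ^ i * elemSymm x s a) := by
  induction i with
  | zero => simp
  | succ i ih =>
    have ih := ih (by omega)
    have h1 := elemSymm_succ_le hx s (a + i)
    have hw : 0 ≤ ∑ i ∈ s, x i := Finset.sum_nonneg fun i _ => hx i
    have hc : (s.card.choose (a + i + 1) : ℝ) * ((a + i : ℕ) + 1) =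
        s.card.choose (a + i) * (s.card - (a + i : ℕ)) := by
      have := Nat.choose_succ_right_eq s.card (a + i)
      rw [← Nat.cast_sub (by omega)]
      exact_mod_cast this
    rw [← add_assoc]
    have hj : (0 : ℝ) < ((a + i : ℕ) : ℝ) + 1 := by positivity
    have hd : (0 : ℝ) ≤ s.card - (a + i : ℕ) := by
      rw [sub_nonneg]; exact_mod_cast (by omega : a + i ≤ s.card)
    generalize ((a + i : ℕ) : ℝ) = J at *
    generalize (∑ i ∈ s, x i) = w at *
    have hK : (0 : ℝ) ≤ s.card := by positivity
    generalize (s.card : ℝ) = K at *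
    have h2 := mul_le_mul_of_nonneg_left h1 (by positivity : 0 ≤ (s.card.choose a : ℝ) * K ^ i)
    have h3 := mul_le_mul_of_nonneg_left ih (mul_nonneg hd hw)
    refine le_of_mul_le_mul_left ?_ hj
    calc (J + 1) * (s.card.choose a * (K ^ (i + 1) * elemSymm x s (a + i + 1)))
        = s.card.choose a * K ^ i * (K * ((J + 1) * elemSymm x s (a + i + 1))) := by ring
      _ ≤ s.card.choose a * K ^ i * ((K - J) * (w * elemSymm x s (a + i))) := h2
      _ = (K - J) * w * (s.card.choose a * (K ^ i * elemSymm x s (a + i))) := by ring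
      _ ≤ (K - J) * w * (s.card.choose (a + i) * (w ^ i * elemSymm x s a)) := h3
      _ = s.card.choose (a + i) * (K - J) * (w ^ (i + 1) * elemSymm x s a) := by ring
      _ = s.card.choose (a + i + 1) * (J + 1) * (w ^ (i + 1) * elemSymm x s a) := by rw [hc]
      _ = _ := by ring

/-- The tangent line bound for `y ↦ (r + y) ^ (j + 1)` at `0`. -/
lemma pow_succ_add_le {r y : ℝ} (hr : 0 ≤ r) (hy : 0 ≤ y) (j : ℕ) :
    r ^ (j + 1) + (j + 1) * (y * r ^ j) ≤ (r + y) ^ (j + 1) := by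
  induction j with
  | zero => simp
  | succ j ih =>
    have h1 := mul_le_mul_of_nonneg_left ih (add_nonneg hr hy)
    have h2 : 0 ≤ ((j : ℝ) + 1) * (y ^ 2 * r ^ j) := by positivity
    calc _ = (r + y) * (r ^ (j + 1) + (j + 1) * (y * r ^ j)) -
          ((j : ℝ) + 1) * (y ^ 2 * r ^ j) := by push_cast; ring
      _ ≤ (r + y) * (r + y) ^ (j + 1) := by linarith
      _ = _ := by ring

/-- Adding new variables of total weight `r` to `Y` raises the symmetric sums at most as much as
splitting `r` into infinitely many infinitesimal variables would. -/
lemma elemSymm_union_le (hx : ∀ i, 0 ≤ x i) (Y O : Finset ι) (hd : Disjoint Y O) (t : ℕ) :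
    elemSymm x (Y ∪ O) t ≤
      ∑ j ∈ Finset.range (t + 1), elemSymm x Y (t - j) * ((∑ i ∈ O, x i) ^ j / j.factorial) := by
  induction O using Finset.induction_on generalizing t with
  | empty =>
    rw [Finset.sum_range_succ']
    simp
  | insert y O hy ih =>
    have hyY : y ∉ Y := fun h => Finset.disjoint_left.1 hd h (Finset.mem_insert_self y O)
    have ih := ih (hd.mono_right (Finset.subset_insert y O))
    rcases t with _ | t
    · simp [elemSymm_zero]
    · rw [Finset.union_insert, elemSymm_insert (by simp [hy, hyY]), Finset.sum_insert hy]
      have h1 := ih (t + 1)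
      have h2 := mul_le_mul_of_nonneg_left (ih t) (hx y)
      have hr : 0 ≤ ∑ i ∈ O, x i := Finset.sum_nonneg fun i _ => hx i
      generalize (∑ i ∈ O, x i) = r at *
      refine (add_le_add h1 h2).trans ?_
      rw [Finset.sum_range_succ' _ (t + 1), Finset.sum_range_succ' _ (t + 1), add_right_comm,
        Finset.mul_sum, ← Finset.sum_add_distrib]
      refine add_le_add (Finset.sum_le_sum fun j _ => ?_) (by simp)
      rw [Nat.add_sub_add_right]
      have h3 := mul_le_mul_of_nonneg_left (div_le_div_of_nonneg_right
        (pow_succ_add_le hr (hx y) j) (by positivity : (0 : ℝ) ≤ ((j + 1).factorial : ℝ)))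
        (elemSymm_nonneg hx Y (t - j))
      rw [add_comm (x y) r]
      refine le_trans (le_of_eq ?_) h3
      rw [Nat.factorial_succ]
      push_cast
      field_simp

lemma elemSymm_le_pow (hx : ∀ i, 0 ≤ x i) (O : Finset ι) (t : ℕ) :
    elemSymm x O t ≤ (∑ i ∈ O, x i) ^ t := by
  have h := elemSymm_union_le hx ∅ O (by simp) t
  rw [Finset.empty_union, Finset.sum_eq_single t] at h
  · rw [Nat.sub_self, elemSymm_zero, one_mul] at h
    refine h.trans (div_le_self (pow_nonneg (Finset.sum_nonneg fun i _ => hx i) _) ?_)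
    exact_mod_cast t.factorial_pos
  · intro j hj hjt
    have : j < t + 1 := Finset.mem_range.1 hj
    rw [elemSymm_eq_zero x (by simp; omega), zero_mul]
  · simp

end ElemSymm

/-! ### Weighted families of `k`-sets with small pairwise intersections -/

/-- The comparison of the coefficients of `M ^ (k - j) * r ^ j` in `pow_mul_sum_prod_le`. The
hypothesis `2 * t ≤ k + 1` on the size of intersections is used here only. -/
lemma pow_mul_choose_sub_le {k t : ℕ} (htk : 2 * t ≤ k + 1) (j : ℕ) (hj : j ≤ t) (hk : t ≤ k) :
    k ^ j * k.choose (t - j) ≤ k.choose t * k.descFactorial j := by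
  induction j with
  | zero => simp
  | succ j ih =>
    have ih := ih (by omega)
    have h1 := Nat.choose_succ_right_eq k (t - (j + 1))
    rw [show t - (j + 1) + 1 = t - j by omega] at h1
    have h2 : k * (t - j) ≤ (k - j) * (k - (t - (j + 1))) := by
      obtain ⟨b, rfl⟩ : ∃ b, t = b + (j + 1) := ⟨t - (j + 1), by omega⟩
      obtain ⟨c, rfl⟩ : ∃ c, k = c + b + j := ⟨k - b - j, by omega⟩
      rw [show b + (j + 1) - j = b + 1 by omega, show b + (j + 1) - (j + 1) = b by omega,
        show c + b + j - j = c + b by omega, show c + b + j - b = c + j by omega]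
      nlinarith
    have h3 : 0 < t - j := by omega
    rw [Nat.descFactorial_succ]
    refine le_of_mul_le_mul_right ?_ h3
    have h4 : 0 < k - (t - (j + 1)) := by omega
    refine le_of_mul_le_mul_right ?_ h4
    calc k ^ (j + 1) * k.choose (t - (j + 1)) * (t - j) * (k - (t - (j + 1)))
        = k ^ j * (k.choose (t - (j + 1)) * (k - (t - (j + 1)))) * (k * (t - j)) := by ring
      _ = k ^ j * k.choose (t - j) * (t - j) * (k * (t - j)) := by rw [← h1]; ring
      _ ≤ (k.choose t * k.descFactorial j) * (t - j) * ((k - j) * (k - (t - (j + 1)))) := by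
        gcongr
      _ = _ := by ring

section Packing

variable {ι : Type*} [DecidableEq ι] {x : ι → ℝ} {𝒴 : Finset (Finset ι)} {W Y₀ : Finset ι}
  {k t : ℕ}

/-- Sets of which any two share fewer than `t` points have no `t`-subset in common. -/
lemma sum_elemSymm_le (hx : ∀ i, 0 ≤ x i) (hW : ∀ Y ∈ 𝒴, Y ⊆ W)
    (hint : ∀ Y ∈ 𝒴, ∀ Y' ∈ 𝒴, Y ≠ Y' → (Y ∩ Y').card < t) :
    ∑ Y ∈ 𝒴, elemSymm x Y t ≤ elemSymm x W t := by
  unfold elemSymm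
  rw [← Finset.sum_biUnion]
  · refine Finset.sum_le_sum_of_subset_of_nonneg ?_ fun _ _ _ => Finset.prod_nonneg fun i _ => hx i
    intro A hA
    obtain ⟨Y, hY, hA⟩ := Finset.mem_biUnion.1 hA
    exact Finset.powersetCard_mono (hW Y hY) hA
  · intro Y hY Y' hY' hne
    rw [Function.onFun, Finset.disjoint_left]
    intro A hA hA'
    rw [Finset.mem_powersetCard] at hA hA'
    have := Finset.card_le_card (Finset.subset_inter hA.1 hA'.1)
    have := hint Y hY Y' hY' hne
    omega

/-- The Lagrangian-type bound: if the `k`-sets in `𝒴` pairwise share at most `(k - 1) / 2` points,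
then the sum of their weight products is at most `(w / k) ^ k`, where `w` is the total weight;
there is even some room if a part `r` of the weight lies outside the heaviest set. -/
lemma pow_mul_sum_prod_le (hx : ∀ i, 0 ≤ x i) (hW : ∀ Y ∈ 𝒴, Y ⊆ W)
    (hcard : ∀ Y ∈ 𝒴, Y.card = k)
    (hint : ∀ Y ∈ 𝒴, ∀ Y' ∈ 𝒴, Y ≠ Y' → (Y ∩ Y').card < t)
    (htk : 2 * t ≤ k + 1) (htk' : t < k) (hY₀ : Y₀ ∈ 𝒴)
    (hmax : ∀ Y ∈ 𝒴, ∑ i ∈ Y, x i ≤ ∑ i ∈ Y₀, x i) :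
    (k : ℝ) ^ k * ∑ Y ∈ 𝒴, ∏ i ∈ Y, x i ≤
      (∑ i ∈ W, x i) ^ k - (∑ i ∈ W \ Y₀, x i) ^ k := by
  have hsplit : ∑ i ∈ W, x i = ∑ i ∈ W \ Y₀, x i + ∑ i ∈ Y₀, x i :=
    (Finset.sum_sdiff (hW Y₀ hY₀)).symm
  have hunion : elemSymm x W t ≤ _ := (Finset.union_sdiff_of_subset (hW Y₀ hY₀)) ▸
    elemSymm_union_le hx Y₀ (W \ Y₀) Finset.disjoint_sdiff t
  have hM : 0 ≤ ∑ i ∈ Y₀, x i := Finset.sum_nonneg fun i _ => hx i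
  have hr : 0 ≤ ∑ i ∈ W \ Y₀, x i := Finset.sum_nonneg fun i _ => hx i
  rw [hsplit]
  set M := ∑ i ∈ Y₀, x i
  set r := ∑ i ∈ W \ Y₀, x i
  have hC : (0 : ℝ) < k.choose t := by exact_mod_cast Nat.choose_pos htk'.le
  have hprod : ∀ Y ∈ 𝒴, (k.choose t : ℝ) * ((k : ℝ) ^ (k - t) * ∏ i ∈ Y, x i) ≤
      M ^ (k - t) * elemSymm x Y t := by
    intro Y hY
    have h := choose_mul_elemSymm_add_le hx Y t (k - t) (by rw [hcard Y hY]; omega)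
    rw [show t + (k - t) = Y.card by rw [hcard Y hY]; omega, elemSymm_card, Nat.choose_self,
      hcard Y hY, Nat.cast_one, one_mul] at h
    refine h.trans (mul_le_mul_of_nonneg_right ?_ (elemSymm_nonneg hx _ _))
    exact pow_le_pow_left₀ (Finset.sum_nonneg fun i _ => hx i) (hmax Y hY) _
  -- the case `a = 0` of the inequality is Maclaurin's `p j ≤ p 1 ^ j`
  have hmac : ∀ j ≤ t, (k : ℝ) ^ j * elemSymm x Y₀ j ≤ k.choose j * M ^ j := by
    intro j hj
    have h := choose_mul_elemSymm_add_le hx Y₀ 0 j (by rw [hcard Y₀ hY₀]; omega)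
    simpa [elemSymm_zero, hcard Y₀ hY₀] using h
  have hsum := sum_elemSymm_le hx hW hint
  rw [← Finset.add_sum_erase 𝒴 _ hY₀] at hsum ⊢
  rw [Finset.sum_range_succ'] at hunion
  simp only [Nat.sub_zero, pow_zero, Nat.factorial_zero, Nat.cast_one, div_one, mul_one]
    at hunion
  have hY₀prod : (k : ℝ) ^ k * ∏ i ∈ Y₀, x i ≤ M ^ k := by
    have h := choose_mul_elemSymm_add_le hx Y₀ 0 k (by rw [hcard Y₀ hY₀]; omega)
    rw [zero_add] at h
    have h2 := elemSymm_card x Y₀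
    rw [hcard Y₀ hY₀] at h h2
    simpa [elemSymm_zero, h2] using h
  have hbinom : ∑ j ∈ Finset.range t, (k.choose (j + 1) : ℝ) * (M ^ (k - (j + 1)) * r ^ (j + 1)) ≤
      (r + M) ^ k - r ^ k - M ^ k := by
    -- as `t < k`, neither of the extreme terms of the binomial sum occurs on the left
    obtain ⟨k', rfl⟩ : ∃ k', k = k' + 1 := ⟨k - 1, by omega⟩
    rw [add_pow, Finset.sum_range_succ, Finset.sum_range_succ']
    simp only [Nat.sub_self, pow_zero, Nat.choose_self, Nat.cast_one, mul_one, Nat.sub_zero,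
      Nat.choose_zero_right, one_mul, add_sub_cancel_right]
    refine le_trans (le_of_eq ?_) (Finset.sum_le_sum_of_subset_of_nonneg
      (Finset.range_mono (by omega : t ≤ k')) fun _ _ _ => by positivity)
    exact Finset.sum_congr rfl fun j _ => by ring
  have hrest : (k.choose t : ℝ) * ((k : ℝ) ^ k * ∑ Y ∈ 𝒴.erase Y₀, ∏ i ∈ Y, x i) ≤
      k.choose t * ((r + M) ^ k - r ^ k - M ^ k) := by
    calc (k.choose t : ℝ) * ((k : ℝ) ^ k * ∑ Y ∈ 𝒴.erase Y₀, ∏ i ∈ Y, x i)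
        = k ^ t * ∑ Y ∈ 𝒴.erase Y₀, (k.choose t : ℝ) * ((k : ℝ) ^ (k - t) * ∏ i ∈ Y, x i) := by
          rw [← Finset.mul_sum, ← Finset.mul_sum]
          conv_lhs => rw [← pow_mul_pow_sub (k : ℝ) htk'.le]
          ring
      _ ≤ k ^ t * ∑ Y ∈ 𝒴.erase Y₀, M ^ (k - t) * elemSymm x Y t := by
          refine mul_le_mul_of_nonneg_left (Finset.sum_le_sum fun Y hY => ?_) (by positivity)
          exact hprod Y (Finset.mem_of_mem_erase hY)
      _ ≤ k ^ t * (M ^ (k - t) * ∑ j ∈ Finset.range t,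
            elemSymm x Y₀ (t - (j + 1)) * (r ^ (j + 1) / (j + 1).factorial)) := by
          rw [← Finset.mul_sum]
          gcongr
          linarith
      _ = ∑ j ∈ Finset.range t, M ^ (k - t) * (k ^ (j + 1) * (k ^ (t - (j + 1)) *
            elemSymm x Y₀ (t - (j + 1)))) * (r ^ (j + 1) / (j + 1).factorial) := by
          rw [Finset.mul_sum, Finset.mul_sum]
          refine Finset.sum_congr rfl fun j hj => ?_
          rw [← pow_mul_pow_sub (k : ℝ) (show j + 1 ≤ t from Finset.mem_range.1 hj)]
          ring
      _ ≤ ∑ j ∈ Finset.range t, k.choose t * (k.choose (j + 1) *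
            (M ^ (k - (j + 1)) * r ^ (j + 1))) := by
          refine Finset.sum_le_sum fun j hj => ?_
          have hj : j + 1 ≤ t := Finset.mem_range.1 hj
          have h1 : (k : ℝ) ^ (j + 1) * k.choose (t - (j + 1)) ≤
              k.choose t * ((j + 1).factorial * k.choose (j + 1)) := by
            have := pow_mul_choose_sub_le htk (j + 1) hj htk'.le
            rw [Nat.descFactorial_eq_factorial_mul_choose] at this
            exact_mod_cast this
          calc M ^ (k - t) * (k ^ (j + 1) * (k ^ (t - (j + 1)) *
                elemSymm x Y₀ (t - (j + 1)))) * (r ^ (j + 1) / (j + 1).factorial)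
              ≤ M ^ (k - t) * (k ^ (j + 1) * (k.choose (t - (j + 1)) * M ^ (t - (j + 1)))) *
                (r ^ (j + 1) / (j + 1).factorial) := by
                gcongr M ^ (k - t) * (k ^ (j + 1) * ?_) * _
                exact hmac _ (by omega)
            _ = (k ^ (j + 1) * k.choose (t - (j + 1))) * (M ^ (k - (j + 1)) *
                (r ^ (j + 1) / (j + 1).factorial)) := by
                rw [show k - (j + 1) = (k - t) + (t - (j + 1)) by omega, pow_add]
                ring
            _ ≤ (k.choose t * ((j + 1).factorial * k.choose (j + 1))) * (M ^ (k - (j + 1)) *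
                (r ^ (j + 1) / (j + 1).factorial)) := by gcongr
            _ = _ := by
                have : ((j + 1).factorial : ℝ) ≠ 0 := by positivity
                field_simp
      _ ≤ _ := by
          rw [← Finset.mul_sum]
          exact mul_le_mul_of_nonneg_left hbinom hC.le
  have := le_of_mul_le_mul_left hrest hC
  rw [mul_add]
  linarith

/-- If all other sets of `𝒴` have two points outside `Y₀`, then they contribute little when
the weight outside `Y₀` is small. -/
lemma sum_prod_le_prod_add (hx : ∀ i, 0 ≤ x i) (hW : ∀ Y ∈ 𝒴, Y ⊆ W)
    (hcard : ∀ Y ∈ 𝒴, Y.card = k) (hY₀ : Y₀ ∈ 𝒴)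
    (hout : ∀ Y ∈ 𝒴, Y ≠ Y₀ → 2 ≤ (Y \ Y₀).card) :
    ∑ Y ∈ 𝒴, ∏ i ∈ Y, x i ≤
      ∏ i ∈ Y₀, x i + (∑ i ∈ W \ Y₀, x i) ^ 2 * (∑ i ∈ W, x i) ^ (k - 2) := by
  rw [← Finset.add_sum_erase 𝒴 _ hY₀]
  refine add_le_add le_rfl ?_
  have hex : ∀ Y : Finset ι, ∃ B : Finset ι, Y ∈ 𝒴.erase Y₀ → B ⊆ Y \ Y₀ ∧ B.card = 2 := by
    intro Y
    by_cases hY : Y ∈ 𝒴.erase Y₀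
    · obtain ⟨B, hB⟩ := Finset.exists_subset_card_eq
        (hout Y (Finset.mem_of_mem_erase hY) (Finset.ne_of_mem_erase hY))
      exact ⟨B, fun _ => hB⟩
    · exact ⟨∅, fun h => absurd h hY⟩
  -- `Y` is recovered from the pair `(β Y, Y \ β Y)`, where `β Y` is a pair outside `Y₀`
  choose β hβ using hex
  have hsub : ∀ Y ∈ 𝒴.erase Y₀, β Y ⊆ Y := fun Y hY =>
    (hβ Y hY).1.trans Finset.sdiff_subset
  calc ∑ Y ∈ 𝒴.erase Y₀, ∏ i ∈ Y, x i
      = ∑ Y ∈ 𝒴.erase Y₀, (fun p : Finset ι × Finset ι => (∏ i ∈ p.1, x i) * ∏ i ∈ p.2, x i)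
          (β Y, Y \ β Y) := by
        refine Finset.sum_congr rfl fun Y hY => ?_
        rw [← Finset.prod_sdiff (hsub Y hY)]
        exact mul_comm _ _
    _ = ∑ p ∈ (𝒴.erase Y₀).image fun Y => (β Y, Y \ β Y),
          (∏ i ∈ p.1, x i) * ∏ i ∈ p.2, x i := by
        rw [Finset.sum_image]
        intro Y hY Y' hY' h
        rw [Prod.mk.injEq] at h
        rw [← Finset.union_sdiff_of_subset (hsub Y hY), ← Finset.union_sdiff_of_subset (hsub Y' hY'),
          h.2, h.1]
    _ ≤ ∑ p ∈ (W \ Y₀).powersetCard 2 ×ˢ W.powersetCard (k - 2),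
          (∏ i ∈ p.1, x i) * ∏ i ∈ p.2, x i := by
        refine Finset.sum_le_sum_of_subset_of_nonneg ?_ fun p _ _ =>
          mul_nonneg (Finset.prod_nonneg fun i _ => hx i) (Finset.prod_nonneg fun i _ => hx i)
        intro p hp
        obtain ⟨Y, hY, rfl⟩ := Finset.mem_image.1 hp
        have hYm := Finset.mem_of_mem_erase hY
        rw [Finset.mem_product, Finset.mem_powersetCard, Finset.mem_powersetCard]
        refine ⟨⟨(hβ Y hY).1.trans (Finset.sdiff_subset_sdiff (hW Y hYm) le_rfl), (hβ Y hY).2⟩,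
          Finset.sdiff_subset.trans (hW Y hYm), ?_⟩
        rw [Finset.card_sdiff_of_subset (hsub Y hY), hcard Y hYm, (hβ Y hY).2]
    _ = elemSymm x (W \ Y₀) 2 * elemSymm x W (k - 2) := by
        rw [Finset.sum_product, elemSymm, elemSymm, Finset.sum_mul_sum]
    _ ≤ _ := mul_le_mul (elemSymm_le_pow hx _ _) (elemSymm_le_pow hx _ _)
        (elemSymm_nonneg hx _ _) (pow_nonneg (Finset.sum_nonneg fun i _ => hx i) _)

end Packing

/-! ### Moving weight to a clique -/

section Symmetrization

variable {ι : Type*} [DecidableEq ι]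

/-- The weights obtained from `x` by moving the whole weight of `v` to `u`. -/
def moveWeight (x : ι → ℕ) (u v : ι) : ι → ℕ :=
  Function.update (Function.update x u (x u + x v)) v 0

lemma moveWeight_of_ne (x : ι → ℕ) {u v i : ι} (hu : i ≠ u) (hv : i ≠ v) :
    moveWeight x u v i = x i := by
  simp [moveWeight, hu, hv]

lemma moveWeight_left (x : ι → ℕ) {u v : ι} (h : u ≠ v) : moveWeight x u v u = x u + x v := by
  simp [moveWeight, h]

lemma moveWeight_right (x : ι → ℕ) (u v : ι) : moveWeight x u v v = 0 := by
  simp [moveWeight]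

lemma sum_moveWeight [Fintype ι] (x : ι → ℕ) {u v : ι} (h : u ≠ v) :
    ∑ i, moveWeight x u v i = ∑ i, x i := by
  have hv : v ∈ Finset.univ.erase u := by simp [h.symm]
  rw [← Finset.add_sum_erase _ _ (Finset.mem_univ u), ← Finset.add_sum_erase _ _ hv,
    ← Finset.add_sum_erase _ x (Finset.mem_univ u), ← Finset.add_sum_erase _ x hv,
    moveWeight_left x h, moveWeight_right, zero_add, ← add_assoc]
  refine congrArg _ (Finset.sum_congr rfl fun i hi => moveWeight_of_ne x ?_ ?_)
  · exact Finset.ne_of_mem_erase (Finset.mem_of_mem_erase hi)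
  · exact Finset.ne_of_mem_erase hi

lemma mul_prod_moveWeight (x : ι → ℕ) {u v : ι} (h : u ≠ v) {Y : Finset ι} (hu : u ∈ Y)
    (hv : v ∉ Y) : x u * ∏ i ∈ Y, moveWeight x u v i = (x u + x v) * ∏ i ∈ Y, x i := by
  have hrest : ∀ i ∈ Y.erase u, moveWeight x u v i = x i := fun i hi =>
    moveWeight_of_ne x (Finset.ne_of_mem_erase hi)
      (ne_of_mem_of_not_mem (Finset.mem_of_mem_erase hi) hv)
  rw [← Finset.mul_prod_erase Y _ hu, ← Finset.mul_prod_erase Y x hu, moveWeight_left x h,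
    Finset.prod_congr rfl hrest]
  ring

/-- The sum of weight products over sets that do not contain both `u` and `v` is affine along the
segment that moves weight between `u` and `v`. -/
lemma mul_prod_eq_moveWeight (x : ι → ℕ) {u v : ι} (h : u ≠ v) {Y : Finset ι}
    (hY : ¬ (u ∈ Y ∧ v ∈ Y)) :
    (x u + x v) * ∏ i ∈ Y, x i =
      x u * ∏ i ∈ Y, moveWeight x u v i + x v * ∏ i ∈ Y, moveWeight x v u i := by
  by_cases hu : u ∈ Y
  · have hv : v ∉ Y := fun hv => hY ⟨hu, hv⟩
    rw [mul_prod_moveWeight x h hu hv, Finset.prod_eq_zero hu (moveWeight_right x v u), mul_zero,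
      add_zero]
  by_cases hv : v ∈ Y
  · rw [mul_prod_moveWeight x h.symm hv hu, Finset.prod_eq_zero hv (moveWeight_right x u v),
      mul_zero, zero_add, add_comm (x u)]
  · have h1 : ∀ i ∈ Y, i ≠ u := fun i hi e => hu (e ▸ hi)
    have h2 : ∀ i ∈ Y, i ≠ v := fun i hi e => hv (e ▸ hi)
    rw [Finset.prod_congr rfl fun i hi => moveWeight_of_ne x (h1 i hi) (h2 i hi),
      Finset.prod_congr rfl fun i hi => moveWeight_of_ne x (h2 i hi) (h1 i hi), add_mul]

/-- Symmetrization: if all members of `𝓗` are cliques of the relation `adj`, the weights can be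
moved to a clique without decreasing the sum of weight products over `𝓗`. -/
lemma exists_weight_on_clique [Fintype ι] {𝓗 : Finset (Finset ι)} {adj : ι → ι → Prop}
    (h𝓗 : ∀ Y ∈ 𝓗, ∀ u ∈ Y, ∀ v ∈ Y, u ≠ v → adj u v) (x : ι → ℕ) :
    ∃ x' : ι → ℕ, ∑ i, x' i = ∑ i, x i ∧
      ∑ Y ∈ 𝓗, ∏ i ∈ Y, x i ≤ ∑ Y ∈ 𝓗, ∏ i ∈ Y, x' i ∧
      ∀ u v, x' u ≠ 0 → x' v ≠ 0 → u ≠ v → adj u v := by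
  induction hc : (Finset.univ.filter fun i => x i ≠ 0).card using Nat.strong_induction_on
    generalizing x with
  | _ c ih =>
    by_cases hcl : ∀ u v, x u ≠ 0 → x v ≠ 0 → u ≠ v → adj u v
    · exact ⟨x, rfl, le_rfl, hcl⟩
    push Not at hcl
    obtain ⟨u, v, hu, hv, huv, hadj⟩ := hcl
    have key : ∀ u v : ι, x u ≠ 0 → x v ≠ 0 → u ≠ v →
        ∑ Y ∈ 𝓗, ∏ i ∈ Y, x i ≤ ∑ Y ∈ 𝓗, ∏ i ∈ Y, moveWeight x u v i →
        ∃ x' : ι → ℕ, ∑ i, x' i = ∑ i, x i ∧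
          ∑ Y ∈ 𝓗, ∏ i ∈ Y, x i ≤ ∑ Y ∈ 𝓗, ∏ i ∈ Y, x' i ∧
          ∀ u v, x' u ≠ 0 → x' v ≠ 0 → u ≠ v → adj u v := by
      intro u v hu hv huv hle
      obtain ⟨x', h1, h2, h3⟩ := ih _ (by
        rw [← hc]
        refine Finset.card_lt_card (Finset.ssubset_iff_of_subset ?_ |>.2 ⟨v, ?_, ?_⟩)
        · intro i hi
          rw [Finset.mem_filter] at hi ⊢
          refine ⟨Finset.mem_univ _, ?_⟩
          by_cases hiu : i = u
          · rwa [hiu]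
          by_cases hiv : i = v
          · rwa [hiv]
          rw [← moveWeight_of_ne x hiu hiv]
          exact hi.2
        · simp [hv]
        · simp [moveWeight_right]) (moveWeight x u v) rfl
      exact ⟨x', h1.trans (sum_moveWeight x huv), hle.trans h2, h3⟩
    have haff : (x u + x v) * ∑ Y ∈ 𝓗, ∏ i ∈ Y, x i =
        x u * ∑ Y ∈ 𝓗, ∏ i ∈ Y, moveWeight x u v i +
          x v * ∑ Y ∈ 𝓗, ∏ i ∈ Y, moveWeight x v u i := by
      rw [Finset.mul_sum, Finset.mul_sum, Finset.mul_sum, ← Finset.sum_add_distrib]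
      exact Finset.sum_congr rfl fun Y hY => mul_prod_eq_moveWeight x huv
        fun h => hadj (h𝓗 Y hY u h.1 v h.2 huv)
    rcases le_total (∑ Y ∈ 𝓗, ∏ i ∈ Y, x i) (∑ Y ∈ 𝓗, ∏ i ∈ Y, moveWeight x u v i) with h | h
    · exact key u v hu hv huv h
    · refine key v u hv hu huv.symm ?_
      have h4 := Nat.mul_le_mul_left (x u) h
      refine Nat.le_of_mul_le_mul_left ?_ (Nat.pos_of_ne_zero hv)
      rw [add_mul] at haff
      omega

end Symmetrization

/-! ### Copies of a Steiner triple system in a cancellative triple system -/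

namespace RGraph

section Copies

variable {W : Type*}

/-- `E` is the set of lines of a Steiner triple system with point set `X`. -/
structure IsTripleSystemOn (X : Finset W) (E : Finset (Finset W)) : Prop where
  subset : ∀ e ∈ E, e ⊆ X
  card_eq : ∀ e ∈ E, e.card = 3
  exists_mem : ∀ u ∈ X, ∀ v ∈ X, u ≠ v → ∃ e ∈ E, u ∈ e ∧ v ∈ e
  eq_of_mem : ∀ e ∈ E, ∀ e' ∈ E, ∀ u v, u ≠ v → u ∈ e → v ∈ e → u ∈ e' → v ∈ e' → e = e'

lemma IsCopy.isTripleSystemOn {V : Type*} [Fintype V] {S : RGraph 3 V}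
    (hS : S.IsSteinerTripleSystem) {H : RGraph 3 W} {X : Finset W} {E : Finset (Finset W)}
    (h : IsCopy S H X E) : IsTripleSystemOn X E := by
  obtain ⟨-, f, rfl, rfl⟩ := h
  have hmem : ∀ e, e ∈ S.mapEdges f ↔ ∃ e' ∈ S.edges, e'.map f = e := fun e => by
    simp [mapEdges]
  refine ⟨?_, ?_, ?_, ?_⟩
  · intro e he
    obtain ⟨e', -, rfl⟩ := (hmem e).1 he
    exact Finset.map_subset_map.2 (Finset.subset_univ _)
  · intro e he
    obtain ⟨e', he', rfl⟩ := (hmem e).1 he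
    rw [Finset.card_map, S.card_eq e' he']
  · intro u hu v hv huv
    obtain ⟨u, -, rfl⟩ := Finset.mem_map.1 hu
    obtain ⟨v, -, rfl⟩ := Finset.mem_map.1 hv
    obtain ⟨e, ⟨he, heu, hev⟩, -⟩ := hS u v fun h => huv (h ▸ rfl)
    exact ⟨e.map f, (hmem _).2 ⟨e, he, rfl⟩, Finset.mem_map_of_mem f heu,
      Finset.mem_map_of_mem f hev⟩
  · intro e he e' he' u v huv hue hve hue' hve'
    obtain ⟨e, hE, rfl⟩ := (hmem e).1 he
    obtain ⟨e', hE', rfl⟩ := (hmem e').1 he'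
    obtain ⟨u, hu, rfl⟩ := Finset.mem_map.1 hue
    obtain ⟨v, hv, rfl⟩ := Finset.mem_map.1 hve
    rw [Finset.mem_map' f] at hue' hve'
    rw [(hS u v fun h => huv (h ▸ rfl)).unique ⟨hE, hu, hv⟩ ⟨hE', hue', hve'⟩]

/-- In a cancellative triple system, two edges that share two points and whose remaining points
are covered by an edge coincide. -/
lemma eq_of_mem_of_cancellative [DecidableEq W] {H : RGraph 3 W}
    (hc : ∀ A ∈ H.edges, ∀ B ∈ H.edges, ∀ C ∈ H.edges, A ≠ B → A ≠ C → B ≠ C →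
      ¬ symmDiff A B ⊆ C)
    {e e' : Finset W} (he : e ∈ H.edges) (he' : e' ∈ H.edges)
    (hadj : ∀ c ∈ e, ∀ c' ∈ e', c ≠ c' → ∃ C ∈ H.edges, c ∈ C ∧ c' ∈ C)
    {u v : W} (huv : u ≠ v) (hu : u ∈ e) (hv : v ∈ e) (hu' : u ∈ e') (hv' : v ∈ e') :
    e = e' := by
  by_contra hne
  have h3 := H.card_eq e he
  have h3' := H.card_eq e' he'
  have h2 : 2 ≤ (e ∩ e').card := by
    rw [← Finset.card_pair huv]
    refine Finset.card_le_card fun z hz => ?_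
    rcases Finset.mem_insert.1 hz with rfl | hz
    · exact Finset.mem_inter.2 ⟨hu, hu'⟩
    · rw [Finset.mem_singleton.1 hz]
      exact Finset.mem_inter.2 ⟨hv, hv'⟩
  -- two triples that share two points differ in exactly one point on either side
  have hlt : ∀ {a b : Finset W}, a.card = 3 → b.card = 3 → a ≠ b → (a \ b).card ≠ 0 := by
    intro a b ha hb hab h0
    rw [Finset.card_eq_zero, Finset.sdiff_eq_empty_iff_subset] at h0
    exact hab (Finset.eq_of_subset_of_card_le h0 (by omega))
  have c1 : (e \ e').card = 1 := by
    have h0 := hlt h3 h3' hne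
    have := Finset.card_sdiff_add_card_inter e e'
    omega
  have c2 : (e' \ e).card = 1 := by
    have h0 := hlt h3' h3 (Ne.symm hne)
    have := Finset.card_sdiff_add_card_inter e' e
    rw [Finset.inter_comm] at this
    omega
  obtain ⟨c, hce⟩ := Finset.card_eq_one.1 c1
  obtain ⟨c', hce'⟩ := Finset.card_eq_one.1 c2
  have m := Finset.mem_sdiff.1 (hce ▸ Finset.mem_singleton_self c : c ∈ e \ e')
  have m' := Finset.mem_sdiff.1 (hce' ▸ Finset.mem_singleton_self c' : c' ∈ e' \ e)
  obtain ⟨C, hC, hcC, hcC'⟩ := hadj c m.1 c' m'.1 fun h => m.2 (h ▸ m'.1)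
  refine hc e he e' he' C hC hne (fun h => m'.2 (h ▸ hcC')) (fun h => m.2 (h ▸ hcC)) ?_
  intro z hz
  rcases Finset.mem_symmDiff.1 hz with hz | hz
  · have : z ∈ e \ e' := Finset.mem_sdiff.2 hz
    rw [hce, Finset.mem_singleton] at this
    rwa [this]
  · have : z ∈ e' \ e := Finset.mem_sdiff.2 hz
    rw [hce', Finset.mem_singleton] at this
    rwa [this]

/-- A proper subsystem of a Steiner triple system contains fewer than half of its points: the
lines through an outer point `y` pair the inner points with further outer points. -/
lemma two_mul_card_inter_lt [DecidableEq W] {X X' : Finset W} {E E' : Finset (Finset W)}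
    (h : IsTripleSystemOn X E) (h' : IsTripleSystemOn X' E')
    (heq : ∀ e ∈ E, ∀ e' ∈ E', ∀ u v, u ≠ v → u ∈ e → v ∈ e → u ∈ e' → v ∈ e' → e = e')
    {y : W} (hy : y ∈ X) (hy' : y ∉ X') : 2 * (X ∩ X').card + 1 ≤ X.card := by
  have hex : ∀ z : W, ∃ p : W, z ∈ X ∩ X' → p ∈ X ∧ p ∉ X' ∧ p ≠ y ∧ p ≠ z ∧
      ∃ e ∈ E, y ∈ e ∧ z ∈ e ∧ p ∈ e := by
    intro z
    by_cases hz : z ∈ X ∩ X'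
    · obtain ⟨hzX, hzX'⟩ := Finset.mem_inter.1 hz
      have hyz : y ≠ z := fun e => hy' (e ▸ hzX')
      obtain ⟨e, he, hye, hze⟩ := h.exists_mem y hy z hzX hyz
      obtain ⟨p, hp, hpne⟩ : ∃ p ∈ e, p ∉ ({y, z} : Finset W) := by
        refine Finset.exists_mem_notMem_of_card_lt_card ?_
        rw [h.card_eq e he, Finset.card_pair hyz]
        norm_num
      simp only [Finset.mem_insert, Finset.mem_singleton, not_or] at hpne
      refine ⟨p, fun _ => ⟨h.subset e he hp, fun hpX' => hy' ?_, hpne.1, hpne.2, e, he, hye, hze,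
        hp⟩⟩
      obtain ⟨e', he', hpe', hze'⟩ := h'.exists_mem p hpX' z hzX' hpne.2
      rw [heq e he e' he' p z hpne.2 hp hze hpe' hze'] at hye
      exact h'.subset e' he' hye
    · exact ⟨y, fun hz' => absurd hz' hz⟩
  choose f hf using hex
  have hle : (X ∩ X').card ≤ ((X \ X').erase y).card := by
    refine Finset.card_le_card_of_injOn f (fun z hz => ?_) fun z hz z' hz' hzz' => ?_
    · obtain ⟨h1, h2, h3, -⟩ := hf z hz
      exact Finset.mem_erase.2 ⟨h3, Finset.mem_sdiff.2 ⟨h1, h2⟩⟩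
    · obtain ⟨-, h2, h3, h4, e, he, hye, hze, hpe⟩ := hf z hz
      obtain ⟨-, -, -, h4', e', he', hye', hze', hpe'⟩ := hf z' hz'
      rw [← hzz'] at hpe' h4'
      have hee := h.eq_of_mem e he e' he' _ _ h3 hpe hye hpe' hye'
      subst hee
      by_contra hne
      have hz2 := (Finset.mem_inter.1 hz).2
      have hz2' := (Finset.mem_inter.1 hz').2
      have hsub : ({y, f z, z, z'} : Finset W) ⊆ e := by
        intro a ha
        simp only [Finset.mem_insert, Finset.mem_singleton] at ha
        rcases ha with rfl | rfl | rfl | rfl <;> assumption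
      have hcard := Finset.card_le_card hsub
      rw [h.card_eq e he, Finset.card_insert_of_notMem, Finset.card_insert_of_notMem,
        Finset.card_pair hne] at hcard
      · omega
      · simp [h4, h4']
      · simp only [Finset.mem_insert, Finset.mem_singleton, not_or]
        exact ⟨h3.symm, fun e => hy' (e ▸ hz2), fun e => hy' (e ▸ hz2')⟩
  rw [Finset.card_erase_of_mem (Finset.mem_sdiff.2 ⟨hy, hy'⟩)] at hle
  have h1 := Finset.card_sdiff_add_card_inter X X'
  have h2 : 0 < (X \ X').card := Finset.card_pos.2 ⟨y, Finset.mem_sdiff.2 ⟨hy, hy'⟩⟩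
  omega

/-- A vertex set of a cancellative triple system spans at most one copy of a Steiner triple
system. -/
lemma IsCopy.subset_of_cancellative [DecidableEq W] {V : Type*} [Fintype V] {S : RGraph 3 V}
    (hS : S.IsSteinerTripleSystem) {H : RGraph 3 W}
    (hc : ∀ A ∈ H.edges, ∀ B ∈ H.edges, ∀ C ∈ H.edges, A ≠ B → A ≠ C → B ≠ C →
      ¬ symmDiff A B ⊆ C)
    {X : Finset W} {E E' : Finset (Finset W)} (h : IsCopy S H X E) (h' : IsCopy S H X E') :
    E ⊆ E' := by
  intro e he
  have hT := h.isTripleSystemOn hS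
  have hT' := h'.isTripleSystemOn hS
  obtain ⟨u, hu, v, hv, huv⟩ := Finset.one_lt_card.1
    (by rw [hT.card_eq e he]; norm_num : 1 < e.card)
  obtain ⟨e', he', hu', hv'⟩ :=
    hT'.exists_mem u (hT.subset e he hu) v (hT.subset e he hv) huv
  rw [eq_of_mem_of_cancellative hc (h.1 he) (h'.1 he') (fun c hce c' hce' hcc' => ?_) huv hu hv
    hu' hv']
  · exact he'
  · obtain ⟨C, hC, h1, h2⟩ := hT.exists_mem c (hT.subset e he hce) c' (hT'.subset e' he' hce') hcc'
    exact ⟨C, h.1 hC, h1, h2⟩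

end Copies

end RGraph

/-! ### Residue classes and balanced products -/

section Balanced

/-- The size of the part of index `j` of the balanced complete `k`-partite graph. -/
def residueCard (k n j : ℕ) : ℕ := (Finset.univ.filter fun x : Fin n => (x : ℕ) % k = j).card

lemma residueCard_eq {k n j : ℕ} (hk : 0 < k) (hj : j < k) :
    residueCard k n j = n / k ∨ residueCard k n j = n / k + 1 := by
  have h := Nat.count_modEq_card n hk j
  have h2 : residueCard k n j = n.count (· ≡ j [MOD k]) := by
    rw [Nat.count_eq_card_filter_range, residueCard, ← Finset.card_map Fin.valEmbedding]
    congr 1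
    ext x
    simp only [Finset.mem_map, Finset.mem_filter, Finset.mem_univ, true_and,
      Fin.valEmbedding_apply, Finset.mem_range, Nat.ModEq, Nat.mod_eq_of_lt hj]
    exact ⟨fun ⟨y, hy, e⟩ => e ▸ ⟨y.2, hy⟩, fun ⟨hx, h⟩ => ⟨⟨x, hx⟩, h, rfl⟩⟩
  rw [h2, h]
  split_ifs <;> simp

lemma sum_residueCard {k n : ℕ} (hk : 0 < k) : ∑ j ∈ Finset.range k, residueCard k n j = n := by
  unfold residueCard
  rw [← Finset.card_eq_sum_card_fiberwise fun x _ =>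
    Finset.mem_coe.2 (Finset.mem_range.2 (Nat.mod_lt _ hk))]
  simp

/-- The exponential through the points `(q, q)` and `(q + 1, q + 1)` dominates the identity on
the integers. -/
lemma natCast_mul_pow_le {q : ℕ} (hq : 0 < q) (a : ℕ) :
    (a : ℝ) * (((q : ℝ) + 1) / q) ^ q ≤ q * (((q : ℝ) + 1) / q) ^ a := by
  have hq' : (0 : ℝ) < q := by exact_mod_cast hq
  have hρ : (0 : ℝ) < ((q : ℝ) + 1) / q := by positivity
  rcases le_total q a with h | h
  · obtain ⟨d, rfl⟩ := Nat.exists_eq_add_of_le h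
    have hb : 1 + (d : ℝ) * (1 / q) ≤ (1 + 1 / (q : ℝ)) ^ d :=
      one_add_mul_le_pow (by have : 0 < 1 / (q : ℝ) := by positivity
                             linarith) d
    rw [show 1 + 1 / (q : ℝ) = (q + 1) / q by field_simp] at hb
    rw [pow_add, mul_comm, mul_left_comm]
    refine mul_le_mul_of_nonneg_left ?_ (by positivity)
    calc ((q + d : ℕ) : ℝ) = q * (1 + d * (1 / q)) := by push_cast; field_simp
      _ ≤ _ := mul_le_mul_of_nonneg_left hb hq'.le
  · obtain ⟨d, hd⟩ := Nat.exists_eq_add_of_le h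
    have hb : 1 + (d : ℝ) * (-(1 / (q + 1))) ≤ (1 + -(1 / ((q : ℝ) + 1))) ^ d := by
      refine one_add_mul_le_pow ?_ d
      have : 1 / ((q : ℝ) + 1) ≤ 1 := by rw [div_le_one (by positivity)]; linarith
      linarith
    rw [show 1 + -(1 / ((q : ℝ) + 1)) = (((q : ℝ) + 1) / q)⁻¹ by field_simp; ring] at hb
    have hpow : (((q : ℝ) + 1) / q) ^ q = (((q : ℝ) + 1) / q) ^ a * (((q : ℝ) + 1) / q) ^ d := by
      rw [← pow_add, ← hd]
    rw [hpow, mul_left_comm, mul_comm (q : ℝ)]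
    refine mul_le_mul_of_nonneg_left ?_ (by positivity)
    have hqd : (q : ℝ) = a + d := by exact_mod_cast hd
    have h1 : (a : ℝ) ≤ q * (1 + d * (-(1 / (q + 1)))) := by
      have : q * (1 + d * (-(1 / ((q : ℝ) + 1)))) - a = d / (q + 1) := by
        field_simp
        rw [hqd]; ring
      have : (0 : ℝ) ≤ d / (q + 1) := by positivity
      linarith
    have h2 := h1.trans (mul_le_mul_of_nonneg_left hb hq'.le)
    calc (a : ℝ) * (((q : ℝ) + 1) / q) ^ d
        ≤ (q * (((q : ℝ) + 1) / q)⁻¹ ^ d) * (((q : ℝ) + 1) / q) ^ d :=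
          mul_le_mul_of_nonneg_right h2 (by positivity)
      _ = q := by
          rw [mul_assoc, ← mul_pow, inv_mul_cancel₀ hρ.ne', one_pow, mul_one]

/-- Equality holds in `natCast_mul_pow_le` at `q` and `q + 1`, which gives the balanced product in
closed form. -/
lemma prod_residueCard_mul_pow {k n : ℕ} (hk : 0 < k) (hn : k ≤ n) :
    (∏ j ∈ Finset.range k, (residueCard k n j : ℝ)) *
        ((((n / k : ℕ) : ℝ) + 1) / (n / k : ℕ)) ^ ((n / k) * k) =
      ((n / k : ℕ) : ℝ) ^ k * ((((n / k : ℕ) : ℝ) + 1) / (n / k : ℕ)) ^ n := by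
  have hq : 0 < n / k := Nat.div_pos hn hk
  have hs := sum_residueCard (n := n) hk
  have hc := fun j (hj : j ∈ Finset.range k) =>
    residueCard_eq (n := n) hk (Finset.mem_range.1 hj)
  generalize n / k = q at *
  have hq' : (q : ℝ) ≠ 0 := by positivity
  calc _ = ∏ j ∈ Finset.range k, ((residueCard k n j : ℝ) * (((q : ℝ) + 1) / q) ^ q) := by
        rw [Finset.prod_mul_distrib, Finset.prod_const, Finset.card_range, pow_mul]
    _ = ∏ j ∈ Finset.range k, ((q : ℝ) * (((q : ℝ) + 1) / q) ^ residueCard k n j) := by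
        refine Finset.prod_congr rfl fun j hj => ?_
        rcases hc j hj with h | h
        · rw [h]
        · rw [h, pow_succ]
          push_cast
          field_simp
    _ = _ := by
        rw [Finset.prod_mul_distrib, Finset.prod_const, Finset.card_range,
          Finset.prod_pow_eq_pow_sum, hs]

/-- Among `k` natural numbers with sum `n`, balanced ones have the largest product. -/
lemma prod_le_prod_residueCard {ι : Type*} {k n : ℕ} (hk : 0 < k) (hn : k ≤ n) (Y : Finset ι)
    (hY : Y.card = k) (x : ι → ℕ) (hx : ∑ i ∈ Y, x i = n) :
    ∏ i ∈ Y, x i ≤ ∏ j ∈ Finset.range k, residueCard k n j := by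
  have hq : 0 < n / k := Nat.div_pos hn hk
  have h := prod_residueCard_mul_pow hk hn
  generalize n / k = q at *
  have hpow : (0 : ℝ) < (((q : ℝ) + 1) / q) ^ (q * k) := by positivity
  have key : (∏ i ∈ Y, (x i : ℝ)) * (((q : ℝ) + 1) / q) ^ (q * k) ≤
      (∏ j ∈ Finset.range k, (residueCard k n j : ℝ)) * (((q : ℝ) + 1) / q) ^ (q * k) := by
    rw [h]
    calc _ = ∏ i ∈ Y, ((x i : ℝ) * (((q : ℝ) + 1) / q) ^ q) := by
          rw [Finset.prod_mul_distrib, Finset.prod_const, hY, pow_mul]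
      _ ≤ ∏ i ∈ Y, ((q : ℝ) * (((q : ℝ) + 1) / q) ^ x i) :=
          Finset.prod_le_prod (fun i _ => by positivity) fun i _ => natCast_mul_pow_le hq _
      _ = _ := by
          rw [Finset.prod_mul_distrib, Finset.prod_const, hY, Finset.prod_pow_eq_pow_sum, hx]
  exact_mod_cast le_of_mul_le_mul_right key hpow

/-- The binomial expansion up to the linear term, with a bound for the remainder. -/
lemma add_pow_le_of_nonneg {a s : ℝ} (ha : 0 ≤ a) (hs : 0 ≤ s) (m : ℕ) :
    (a + s) ^ (m + 2) ≤
      a ^ (m + 2) + (m + 2) * (s * a ^ (m + 1)) + (m + 2) ^ 2 * s ^ 2 * (a + s) ^ m := by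
  induction m with
  | zero => norm_num; nlinarith [sq_nonneg s]
  | succ m ih =>
    have h1 := mul_le_mul_of_nonneg_left ih (add_nonneg ha hs)
    have h2 : a ^ (m + 1) ≤ (a + s) ^ (m + 1) := pow_le_pow_left₀ ha (by linarith) _
    have h3 := mul_le_mul_of_nonneg_left h2 (by positivity : 0 ≤ ((m : ℝ) + 2) * s ^ 2)
    have h4 : 0 ≤ ((m : ℝ) + 3) * s ^ 2 * (a + s) ^ (m + 1) := by positivity
    calc (a + s) ^ (m + 1 + 2) = (a + s) * (a + s) ^ (m + 2) := by ring
      _ ≤ _ := h1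
      _ = a ^ (m + 3) + (m + 3) * (s * a ^ (m + 2)) + (m + 2) * s ^ 2 * a ^ (m + 1) +
          (m + 2) ^ 2 * s ^ 2 * (a + s) ^ (m + 1) := by ring
      _ ≤ a ^ (m + 3) + (m + 3) * (s * a ^ (m + 2)) + (m + 2) * s ^ 2 * (a + s) ^ (m + 1) +
          (m + 2) ^ 2 * s ^ 2 * (a + s) ^ (m + 1) + (m + 3) * s ^ 2 * (a + s) ^ (m + 1) := by
        linarith
      _ = _ := by push_cast; ring

/-- The balanced product differs from `(n / k) ^ k` by terms of order `n ^ (k - 2)` only. -/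
lemma pow_sub_le_prod_residueCard {k n : ℕ} (hk : 2 ≤ k) (hn : k ≤ n) :
    (n : ℝ) ^ k - (k : ℝ) ^ 4 * (n : ℝ) ^ (k - 2) ≤
      (k : ℝ) ^ k * ∏ j ∈ Finset.range k, (residueCard k n j : ℝ) := by
  have hk0 : 0 < k := by omega
  have hq : 0 < n / k := Nat.div_pos hn hk0
  have h := prod_residueCard_mul_pow hk0 hn
  have hdm := Nat.div_add_mod' n k
  have hs : n % k < k := Nat.mod_lt _ hk0
  generalize n / k = q at *
  generalize n % k = s at *
  generalize (∏ j ∈ Finset.range k, (residueCard k n j : ℝ)) = T at *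
  have hq' : (0 : ℝ) < q := by exact_mod_cast hq
  have hT : T = q ^ k * (((q : ℝ) + 1) / q) ^ s := by
    rw [← hdm, pow_add] at h
    have hpow : (((q : ℝ) + 1) / q) ^ (q * k) ≠ 0 := by positivity
    refine mul_right_cancel₀ hpow ?_
    rw [h]; ring
  obtain ⟨m, rfl⟩ : ∃ m, k = m + 2 := ⟨k - 2, by omega⟩
  have hb : 1 + (s : ℝ) * (1 / q) ≤ (((q : ℝ) + 1) / q) ^ s := by
    have := one_add_mul_le_pow (a := 1 / (q : ℝ)) (by
      have : 0 < 1 / (q : ℝ) := by positivity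
      linarith) s
    rwa [show 1 + 1 / (q : ℝ) = (q + 1) / q by field_simp] at this
  have hT' : (q : ℝ) ^ (m + 2) + s * q ^ (m + 1) ≤ T := by
    rw [hT]
    calc _ = (q : ℝ) ^ (m + 2) * (1 + s * (1 / q)) := by field_simp; ring
      _ ≤ _ := mul_le_mul_of_nonneg_left hb (by positivity)
  have h1 := mul_le_mul_of_nonneg_left hT' (by positivity : (0 : ℝ) ≤ ((m + 2 : ℕ) : ℝ) ^ (m + 2))
  have h2 := add_pow_le_of_nonneg (a := (q : ℝ) * (m + 2 : ℕ)) (s := s) (by positivity)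
    (by positivity) m
  have h3 : (n : ℝ) = (q : ℝ) * (m + 2 : ℕ) + s := by exact_mod_cast hdm.symm
  have h4 : (s : ℝ) ^ 2 ≤ ((m + 2 : ℕ) : ℝ) ^ 2 :=
    pow_le_pow_left₀ (by positivity) (by exact_mod_cast hs.le) 2
  have h5 := mul_le_mul_of_nonneg_left h4
    (by positivity : (0 : ℝ) ≤ ((m : ℝ) + 2) ^ 2 * (n : ℝ) ^ m)
  rw [← h3] at h2
  rw [Nat.add_sub_cancel]
  push_cast at *
  have e1 : ((m : ℝ) + 2) ^ (m + 2) * ((q : ℝ) ^ (m + 2) + s * q ^ (m + 1)) =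
      (q * (m + 2)) ^ (m + 2) + (m + 2) * (s * (q * (m + 2)) ^ (m + 1)) := by
    rw [mul_pow, mul_pow]; ring
  rw [e1] at h1
  have e2 : ((m : ℝ) + 2) ^ 2 * (n : ℝ) ^ m * (m + 2) ^ 2 = (m + 2) ^ 4 * n ^ m := by ring
  nlinarith

end Balanced

namespace RGraph

/-- Choosing one vertex in each residue class yields an edge; equality holds, but only this
inequality is needed. -/
lemma prod_residueCard_le_card_edges {k n : ℕ} :
    ∏ j ∈ Finset.range k, residueCard k n j ≤ (balancedCompletePartite k n).edges.card := by
  classical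
  rw [← Fin.prod_univ_eq_prod_range (fun j => residueCard k n j)]
  unfold residueCard
  rw [← Fintype.card_piFinset]
  refine Finset.card_le_card_of_injOn (fun g => Finset.univ.image g) (fun g hg => ?_)
    fun g hg g' hg' h => ?_
  · have hg' : ∀ j : Fin k, (g j : ℕ) % k = j := by simpa using hg
    have hinj : Function.Injective g := fun i j hij => by
      rw [Fin.ext_iff, ← hg' i, ← hg' j, hij]
    simp only [balancedCompletePartite, Finset.coe_filter, Finset.mem_powersetCard, Set.mem_ofPred_eq]
    refine ⟨⟨Finset.subset_univ _, by simp [Finset.card_image_of_injective _ hinj]⟩, ?_⟩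
    intro j hj
    refine Finset.card_eq_one.2 ⟨g ⟨j, hj⟩, ?_⟩
    ext y
    simp only [Finset.mem_filter, Finset.mem_image, Finset.mem_univ, true_and,
      Finset.mem_singleton]
    constructor
    · rintro ⟨⟨i, rfl⟩, hi⟩
      rw [hg' i] at hi
      congr 1
      exact Fin.ext hi
    · rintro rfl
      exact ⟨⟨_, rfl⟩, hg' _⟩
  · have hg1 : ∀ j : Fin k, (g j : ℕ) % k = j := by simpa using hg
    have hg2 : ∀ j : Fin k, (g' j : ℕ) % k = j := by simpa using hg'
    funext j
    have hm : g j ∈ Finset.univ.image g' := by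
      have : g j ∈ Finset.univ.image g := Finset.mem_image_of_mem _ (Finset.mem_univ _)
      simpa only [← h] using this
    obtain ⟨i, -, hi⟩ := Finset.mem_image.1 hm
    have : i = j := by rw [Fin.ext_iff, ← hg2 i, ← hg1 j, hi]
    rw [← hi, this]

end RGraph

/-! ### The upper bound -/

section Numerics

/-- `P ≤ T` follows from `hfar` (as in `pow_mul_sum_prod_le`) if `r ≥ n / (2 * k ^ k)`, and from
`hnear` and `hQ` (as in `sum_prod_le_prod_add`) otherwise. Here `r` is the weight outside the
heaviest set, `Q` the product over that set, and `T` the balanced product. -/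
lemma le_of_weight_bounds {k n r : ℕ} (hk : 2 ≤ k) (hn : 2 * k ^ 4 * (2 * k ^ k) ^ k ≤ n)
    (hr : 1 ≤ r) (hrn : r ≤ n) {P Q T : ℝ}
    (hT : (n : ℝ) ^ k - (k : ℝ) ^ 4 * (n : ℝ) ^ (k - 2) ≤ (k : ℝ) ^ k * T)
    (hfar : (k : ℝ) ^ k * P ≤ (n : ℝ) ^ k - (r : ℝ) ^ k)
    (hnear : P ≤ Q + (r : ℝ) ^ 2 * (n : ℝ) ^ (k - 2))
    (hQ : (k : ℝ) ^ k * Q ≤ ((n : ℝ) - r) ^ k) : P ≤ T := by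
  obtain ⟨m, rfl⟩ : ∃ m, k = m + 2 := ⟨k - 2, by omega⟩
  rw [Nat.add_sub_cancel] at *
  have hkk : (0 : ℝ) < ((m + 2 : ℕ) : ℝ) ^ (m + 2) := by positivity
  have hk1 : (1 : ℝ) ≤ ((m + 2 : ℕ) : ℝ) := by exact_mod_cast (by omega : 1 ≤ m + 2)
  have hn' : 2 * ((m + 2 : ℕ) : ℝ) ^ 4 * (2 * ((m + 2 : ℕ) : ℝ) ^ (m + 2)) ^ (m + 2) ≤ n := by
    exact_mod_cast hn
  have hr1 : (1 : ℝ) ≤ r := by exact_mod_cast hr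
  have hrn' : (r : ℝ) ≤ n := by exact_mod_cast hrn
  generalize ((m + 2 : ℕ) : ℝ) = K at *
  generalize (r : ℝ) = R at *
  generalize (n : ℝ) = N at *
  have hN1 : 1 ≤ N := hr1.trans hrn'
  have hNm : 0 < N ^ m := by positivity
  refine le_of_mul_le_mul_left ?_ hkk
  have hK4 : 1 ≤ K ^ 4 := one_le_pow₀ hk1
  have hKK : 1 ≤ K ^ (m + 2) := one_le_pow₀ hk1
  set D := 2 * K ^ (m + 2) with hD
  have hDp : 1 ≤ D ^ (m + 2) := one_le_pow₀ (by linarith)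
  rcases le_total N (D * R) with h | h
  · -- a positive proportion of the weight lies outside
    have h1 : N ^ (m + 2) ≤ D ^ (m + 2) * R ^ (m + 2) := by
      rw [← mul_pow]
      exact pow_le_pow_left₀ (by linarith) h _
    have h2 : D ^ (m + 2) * (K ^ 4 * N ^ m) ≤ D ^ (m + 2) * R ^ (m + 2) := by
      refine le_trans ?_ h1
      have h3 : D ^ (m + 2) * K ^ 4 ≤ N ^ 2 := by nlinarith
      calc _ = D ^ (m + 2) * K ^ 4 * N ^ m := by ring
        _ ≤ N ^ 2 * N ^ m := by gcongr
        _ = _ := by ring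
    have h4 := le_of_mul_le_mul_left h2 (by linarith)
    linarith
  · -- the loss of order `R * N ^ (m + 1)` in `Q` outweighs both error terms
    have h1 : (N - R) ^ (m + 2) ≤ N ^ (m + 2) - R * N ^ (m + 1) := by
      calc (N - R) ^ (m + 2) = (N - R) * (N - R) ^ (m + 1) := by ring
        _ ≤ (N - R) * N ^ (m + 1) := by
          refine mul_le_mul_of_nonneg_left (pow_le_pow_left₀ ?_ ?_ _) ?_ <;> linarith
        _ = _ := by ring
    have h2 := mul_le_mul_of_nonneg_left hnear hkk.le
    have h3 : 2 * (K ^ (m + 2) * (R ^ 2 * N ^ m)) ≤ R * N ^ (m + 1) := by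
      calc _ = (D * R) * (R * N ^ m) := by rw [hD]; ring
        _ ≤ N * (R * N ^ m) := by gcongr
        _ = _ := by ring
    have h4 : 2 * K ^ 4 ≤ N := le_trans (le_mul_of_one_le_right (by positivity) hDp) hn'
    have h5 : 2 * (K ^ 4 * N ^ m) ≤ R * N ^ (m + 1) := by
      calc _ = 2 * K ^ 4 * N ^ m := by ring
        _ ≤ N * N ^ m := by gcongr
        _ = 1 * N ^ (m + 1) := by ring
        _ ≤ _ := by gcongr
    linarith

end Numerics

/-- A family of `k`-sets that pairwise share at most `(k - 1) / 2` points, with natural weights of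
large sum, has at most the balanced sum of weight products. -/
lemma sum_prod_le_prod_residueCard {ι : Type*} [DecidableEq ι] {k n : ℕ} (hk : 3 ≤ k)
    (hn : 2 * k ^ 4 * (2 * k ^ k) ^ k ≤ n) {𝒴 : Finset (Finset ι)} {W : Finset ι}
    (hW : ∀ Y ∈ 𝒴, Y ⊆ W) (hcard : ∀ Y ∈ 𝒴, Y.card = k)
    (hint : ∀ Y ∈ 𝒴, ∀ Y' ∈ 𝒴, Y ≠ Y' → 2 * (Y ∩ Y').card + 1 ≤ k)
    (x : ι → ℕ) (hx : ∑ i ∈ W, x i = n) :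
    ∑ Y ∈ 𝒴, ∏ i ∈ Y, x i ≤ ∏ j ∈ Finset.range k, residueCard k n j := by
  rcases 𝒴.eq_empty_or_nonempty with rfl | hne
  · simp
  obtain ⟨Y₀, hY₀, hmax⟩ := Finset.exists_max_image 𝒴 (fun Y => ∑ i ∈ Y, x i) hne
  have hkn : k ≤ n := by
    refine le_trans ?_ hn
    have h1 : 1 ≤ (2 * k ^ k) ^ k := Nat.one_le_pow _ _ (by positivity)
    have h2 : k ≤ k ^ 4 := Nat.le_self_pow (by norm_num) k
    nlinarith
  have hx0 : ∀ i, (0 : ℝ) ≤ (x i : ℝ) := fun i => Nat.cast_nonneg _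
  have hnear := sum_prod_le_prod_add hx0 hW hcard hY₀ (fun Y hY hne => by
    have h1 := hint Y hY Y₀ hY₀ hne
    have h2 := Finset.card_sdiff_add_card_inter Y Y₀
    have h3 := hcard Y hY
    omega)
  have hsplit := Finset.sum_sdiff (f := x) (hW Y₀ hY₀)
  rw [hx] at hsplit
  rw [← Nat.cast_sum, ← Nat.cast_sum, hx] at hnear
  have hfar := pow_mul_sum_prod_le (t := (k + 1) / 2) hx0 hW hcard
    (fun Y hY Y' hY' hne => by have := hint Y hY Y' hY' hne; omega) (by omega) (by omega) hY₀
    (fun Y hY => by exact_mod_cast hmax Y hY)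
  rw [← Nat.cast_sum, ← Nat.cast_sum, hx] at hfar
  rcases Nat.eq_zero_or_pos (∑ i ∈ W \ Y₀, x i) with h0 | hpos
  · rw [h0, zero_add] at hsplit
    have hb := prod_le_prod_residueCard (by omega) hkn Y₀ (hcard Y₀ hY₀) x hsplit
    rw [h0] at hnear
    refine le_trans ?_ hb
    have : (∑ Y ∈ 𝒴, ∏ i ∈ Y, (x i : ℝ)) ≤ ∏ i ∈ Y₀, (x i : ℝ) := by simpa using hnear
    exact_mod_cast this
  · have hT := pow_sub_le_prod_residueCard (by omega : 2 ≤ k) hkn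
    have hQ : (k : ℝ) ^ k * ∏ i ∈ Y₀, (x i : ℝ) ≤
        ((n : ℝ) - (∑ i ∈ W \ Y₀, x i : ℕ)) ^ k := by
      have h := choose_mul_elemSymm_add_le hx0 Y₀ 0 k (by rw [hcard Y₀ hY₀]; omega)
      have h2 := elemSymm_card (fun i => (x i : ℝ)) Y₀
      rw [zero_add] at h
      rw [hcard Y₀ hY₀] at h h2
      rw [show (n : ℝ) - (∑ i ∈ W \ Y₀, x i : ℕ) = ∑ i ∈ Y₀, (x i : ℝ) by
        rw [← hsplit]; push_cast; ring]
      simpa [elemSymm_zero, h2] using h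
    have := le_of_weight_bounds (by omega) hn hpos (by omega) hT hfar hnear hQ
    exact_mod_cast this

namespace RGraph

/-- The symmetrized form of the family of copies satisfies the hypotheses of
`sum_prod_le_prod_residueCard`, because two copies inside a clique of the shadow share less than
half of their vertices. -/
lemma numCopies_le {V : Type*} [Fintype V] {k n : ℕ} (hk : 3 ≤ k) (hV : Fintype.card V = k)
    (hn : 2 * k ^ 4 * (2 * k ^ k) ^ k ≤ n) {S : RGraph 3 V} (hS : S.IsSteinerTripleSystem)
    {H : RGraph 3 (Fin n)} (hH : H.IsFree (cancellativeFamily 3)) :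
    numCopies S H ≤ ∏ j ∈ Finset.range k, residueCard k n j := by
  classical
  have hc := (isFree_cancellativeFamily_iff H).1 hH
  set 𝓗 : Finset (Finset (Fin n)) := Finset.univ.filter fun X => ∃ E, IsCopy S H X E with h𝓗
  have hmem : ∀ X, X ∈ 𝓗 ↔ ∃ E, IsCopy S H X E := fun X => by simp [h𝓗]
  have hnum : numCopies S H ≤ 𝓗.card := by
    rw [numCopies, ← Set.ncard_coe_finset]
    refine Set.ncard_le_ncard_of_injOn Prod.fst (fun P hP => (hmem _).2 ⟨P.2, hP⟩) ?_
    rintro ⟨X, E⟩ hP ⟨X', E'⟩ hP' (rfl : X = X')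
    have h1 : IsCopy S H X E := hP
    have h2 : IsCopy S H X E' := hP'
    rw [(h1.subset_of_cancellative hS hc h2).antisymm (h2.subset_of_cancellative hS hc h1)]
  obtain ⟨x, hsum, hle, hcl⟩ := exists_weight_on_clique (𝓗 := 𝓗)
    (adj := fun u v => ∃ C ∈ H.edges, u ∈ C ∧ v ∈ C) (fun Y hY u hu v hv huv => by
      obtain ⟨E, hE⟩ := (hmem Y).1 hY
      obtain ⟨e, he, h⟩ := (hE.isTripleSystemOn hS).exists_mem u hu v hv huv
      exact ⟨e, hE.1 he, h⟩) (fun _ => 1)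
  simp only [Finset.sum_const, Finset.card_univ, Fintype.card_fin, Finset.prod_const_one,
    smul_eq_mul, mul_one] at hsum hle
  refine hnum.trans (hle.trans ?_)
  set W : Finset (Fin n) := Finset.univ.filter fun i => x i ≠ 0 with hWdef
  have hsupp : ∑ Y ∈ 𝓗, ∏ i ∈ Y, x i = ∑ Y ∈ 𝓗.filter (· ⊆ W), ∏ i ∈ Y, x i := by
    refine (Finset.sum_filter_of_ne fun Y _ hne i hi => ?_).symm
    exact Finset.mem_filter.2 ⟨Finset.mem_univ i, fun h0 => hne (Finset.prod_eq_zero hi h0)⟩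
  rw [hsupp]
  have hcard : ∀ Y ∈ 𝓗, Y.card = k := fun Y hY => by
    obtain ⟨E, -, f, rfl, -⟩ := (hmem Y).1 hY
    rw [Finset.card_map, Finset.card_univ, hV]
  refine sum_prod_le_prod_residueCard (W := W) hk hn (fun Y hY => (Finset.mem_filter.1 hY).2)
    (fun Y hY => hcard Y (Finset.mem_filter.1 hY).1) (fun Y hY Y' hY' hne => ?_) x ?_
  · obtain ⟨hY, hYW⟩ := Finset.mem_filter.1 hY
    obtain ⟨hY', hYW'⟩ := Finset.mem_filter.1 hY'
    obtain ⟨E, hE⟩ := (hmem Y).1 hY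
    obtain ⟨E', hE'⟩ := (hmem Y').1 hY'
    have hT := hE.isTripleSystemOn hS
    have hT' := hE'.isTripleSystemOn hS
    obtain ⟨y, hy, hy'⟩ : ∃ y ∈ Y, y ∉ Y' := by
      by_contra! h
      exact hne (Finset.eq_of_subset_of_card_le h (by rw [hcard Y hY, hcard Y' hY']))
    rw [← hcard Y hY]
    refine two_mul_card_inter_lt hT hT' (fun e he e' he' u v huv hu hv hu' hv' => ?_) hy hy'
    refine eq_of_mem_of_cancellative hc (hE.1 he) (hE'.1 he') (fun c hc c' hc' hcc' => ?_) huv hu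
      hv hu' hv'
    exact hcl c c' (Finset.mem_filter.1 (hYW (hT.subset e he hc))).2
      (Finset.mem_filter.1 (hYW' (hT'.subset e' he' hc'))).2 hcc'
  · exact (Finset.sum_filter_ne_zero _).trans hsum

/-! ### The lower bound -/

/-- The blow-up of `S` along a map `φ`: the triples that `φ` maps bijectively onto an edge. -/
def blowUp {V W : Type*} [Fintype W] [DecidableEq V] (S : RGraph 3 V) (φ : W → V) :
    RGraph 3 W where
  edges := (Finset.powersetCard 3 Finset.univ).filter fun e => e.image φ ∈ S.edges
  card_eq := fun _ he => (Finset.mem_powersetCard.1 (Finset.mem_filter.1 he).1).2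

lemma mem_edges_blowUp {V W : Type*} [Fintype W] [DecidableEq V] {S : RGraph 3 V} {φ : W → V}
    {e : Finset W} : e ∈ (S.blowUp φ).edges ↔ e.card = 3 ∧ e.image φ ∈ S.edges := by
  simp [blowUp, Finset.mem_powersetCard]

/-- Blow-ups of Steiner triple systems are cancellative: `A`, `B` with `A ∆ B ⊆ C` share two
vertices, so they lie over the same edge of `S`, and then `C` has two vertices in one fibre. -/
lemma isFree_blowUp {V : Type*} [DecidableEq V] {S : RGraph 3 V} (hS : S.IsSteinerTripleSystem)
    {n : ℕ} (φ : Fin n → V) : (S.blowUp φ).IsFree (cancellativeFamily 3) := by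
  rw [isFree_cancellativeFamily_iff]
  intro A hA B hB C hC hAB _ _ hsub
  have hinj : ∀ e ∈ (S.blowUp φ).edges, Set.InjOn φ e := fun e he => by
    obtain ⟨h1, h2⟩ := mem_edges_blowUp.1 he
    exact Finset.card_image_iff.1 (by rw [S.card_eq _ h2, h1])
  have hA3 := (mem_edges_blowUp.1 hA).1
  have hB3 := (mem_edges_blowUp.1 hB).1
  have hC3 := (mem_edges_blowUp.1 hC).1
  obtain ⟨b, hbB, hbA⟩ : ∃ b ∈ B, b ∉ A := by
    by_contra! h
    exact hAB (Finset.eq_of_subset_of_card_le h (by omega)).symm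
  have h2 : 1 < (A ∩ B).card := by
    -- `|A ∆ B| = 6 - 2 * |A ∩ B|` is at most `|C| = 3`
    have h3 : (A \ B).card + (B \ A).card ≤ 3 := by
      rw [← hC3, ← Finset.card_union_of_disjoint disjoint_sdiff_sdiff]
      exact Finset.card_le_card hsub
    have h4 := Finset.card_sdiff_add_card_inter A B
    have h5 := Finset.card_sdiff_add_card_inter B A
    rw [Finset.inter_comm B A] at h5
    omega
  obtain ⟨u, hu, v, hv, huv⟩ := Finset.one_lt_card.1 h2
  rw [Finset.mem_inter] at hu hv
  have himg : A.image φ = B.image φ :=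
    (hS (φ u) (φ v) fun h => huv (hinj A hA hu.1 hv.1 h)).unique
      ⟨(mem_edges_blowUp.1 hA).2, Finset.mem_image_of_mem φ hu.1, Finset.mem_image_of_mem φ hv.1⟩
      ⟨(mem_edges_blowUp.1 hB).2, Finset.mem_image_of_mem φ hu.2, Finset.mem_image_of_mem φ hv.2⟩
  obtain ⟨z, hzA, hz⟩ := Finset.mem_image.1 (himg ▸ Finset.mem_image_of_mem φ hbB)
  by_cases hzB : z ∈ B
  · exact hbA (hinj B hB hzB hbB hz ▸ hzA)
  · have hzC : z ∈ C := hsub (Finset.mem_symmDiff.2 (Or.inl ⟨hzA, hzB⟩))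
    have hbC : b ∈ C := hsub (Finset.mem_symmDiff.2 (Or.inr ⟨hbB, hbA⟩))
    exact hbA (hinj C hC hzC hbC hz ▸ hzA)

/-- In the blow-up of `S` along the residues modulo `k`, every transversal spans a copy of `S`. -/
lemma exists_card_edges_le_numCopies {V : Type*} [Fintype V] {k : ℕ} (hk : 0 < k)
    (hV : Fintype.card V = k) {S : RGraph 3 V} (hS : S.IsSteinerTripleSystem) (n : ℕ) :
    ∃ H : RGraph 3 (Fin n), H.IsFree (cancellativeFamily 3) ∧
      (balancedCompletePartite k n).edges.card ≤ numCopies S H := by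
  classical
  let σ : V ≃ Fin k := Fintype.equivFinOfCardEq hV
  let φ : Fin n → V := fun x => σ.symm ⟨(x : ℕ) % k, Nat.mod_lt _ hk⟩
  have hφ : ∀ (x : Fin n) (v : V), (x : ℕ) % k = σ v → φ x = v := fun x v h => by
    rw [Equiv.symm_apply_eq, Fin.ext_iff]
    exact h
  refine ⟨S.blowUp φ, isFree_blowUp hS φ, ?_⟩
  rw [numCopies, ← Set.ncard_coe_finset]
  refine le_trans (Set.ncard_le_ncard (t := Prod.fst ''
    {P : Finset (Fin n) × Finset (Finset (Fin n)) | IsCopy S (S.blowUp φ) P.1 P.2}) ?_)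
    (Set.ncard_image_le (Set.toFinite _))
  intro X hX
  obtain ⟨hXk, hXj⟩ := Finset.mem_filter.1 (Finset.mem_coe.1 hX)
  have hex : ∀ v : V, ∃ x ∈ X, φ x = v := fun v => by
    obtain ⟨x, hx⟩ := Finset.card_eq_one.1 (hXj (σ v) (σ v).2)
    have hx := Finset.mem_filter.1 (hx ▸ Finset.mem_singleton_self x)
    exact ⟨x, hx.1, hφ x v hx.2⟩
  choose g hgX hg using hex
  let f : V ↪ Fin n := ⟨g, fun u v h => by rw [← hg u, ← hg v, h]⟩
  refine ⟨(X, S.mapEdges f), ⟨?_, f, ?_, rfl⟩, rfl⟩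
  · intro e he
    obtain ⟨e', he', rfl⟩ := Finset.mem_map.1 he
    have himg : (e'.map f).image φ = e' := by
      rw [Finset.map_eq_image, Finset.image_image]
      exact (Finset.image_congr fun v _ => hg v).trans Finset.image_id
    exact mem_edges_blowUp.2
      ⟨(Finset.card_map f).trans (S.card_eq e' he'), himg.symm ▸ he'⟩
  · refine Finset.eq_of_subset_of_card_le (fun x hx => ?_) ?_
    · obtain ⟨v, -, rfl⟩ := Finset.mem_map.1 hx
      exact hgX v
    · rw [Finset.card_map, Finset.card_univ, hV, (Finset.mem_powersetCard.1 hXk).2]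

end RGraph

theorem theorem6p1 {V : Type*} [Fintype V] (k : ℕ) (hk : 3 ≤ k) (hV : Fintype.card V = k)
    (S : RGraph 3 V) (hS : S.IsSteinerTripleSystem) :
    ∃ n₀ : ℕ, ∀ n : ℕ, n₀ ≤ n →
      RGraph.generalizedTuranNumber n S (RGraph.cancellativeFamily 3) =
        (RGraph.balancedCompletePartite k n).edges.card := by
  refine ⟨2 * k ^ 4 * (2 * k ^ k) ^ k, fun n hn => ?_⟩
  have hmax := RGraph.isGreatest_generalizedTuranNumber n S
  refine le_antisymm ?_ ?_
  · obtain ⟨H, hH, hN⟩ := hmax.1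
    rw [← hN]
    exact (RGraph.numCopies_le hk hV hn hS hH).trans RGraph.prod_residueCard_le_card_edges
  · obtain ⟨H, hH, hle⟩ := RGraph.exists_card_edges_le_numCopies (by omega) hV hS n
    exact hle.trans (hmax.2 ⟨H, hH, rfl⟩)
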